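/- For $b \in \mathbb{Z}$ consider the product $\prod_{p \mid b} \left(1 - \frac{1}{p^2}\right)$ over all primes $p$ dividing $b$ (the empty product is $1$; for $b = 0$ it is the infinite product over all primes), and let $$D_2 = \left\{ \prod_{p \mid b} \left(1 - \frac{1}{p^2}\right) : b \in \mathbb{Z} \right\} \subset \mathbb{R}.$$ Then the closure of $D_2$ in $\mathbb{R}$ is $$\overline{D_2} = \left[\frac{6}{\pi^2}, \frac{2}{3}\right] \cup \left[\frac{27}{4\pi^2}, \frac{3}{4}\right] \cup \left[\frac{8}{\pi^2}, \frac{8}{9}\right] \cup \left[\frac{9}{\pi^2}, 1\right].$$ -/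

import Mathlib

/-- The product of `1 - 1 / p ^ n` over all primes `p` dividing the integer `b`.
For `b ≠ 0` this is a finite product; for `b = 0` every prime divides `b`, and it is the
(for `n ≥ 2` convergent) infinite product over all primes. -/
noncomputable def visibleDensity (n : ℕ) (b : ℤ) : ℝ :=
  ∏' p : {p : ℕ // p.Prime ∧ (p : ℤ) ∣ b}, (1 - 1 / ((p : ℕ) : ℝ) ^ n)

/-- The density set `D_n`: all values of `∏_{p ∣ b} (1 - 1 / p ^ n)` for integers `b`
(including `b = 0`). -/
def densitySet (n : ℕ) : Set ℝ := {x | ∃ b : ℤ, x = visibleDensity n b}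

/-! Taking `-log` turns products over primes `p ≥ 5` into subsums of `∑ -log (1 - 1/p²)`. By
Kakeya's criterion these subsums are dense in the whole interval from `0` to the sum, provided each
term is at most the tail after it. Since `1/p² ≤ -log (1 - 1/p²) ≤ 1/(p² - 1)`, four primes in `(p,
2p)` suffice: `4/(2p - 1)² ≥ 1/(p² - 1)`. Erdős's proof of Bertrand's postulate supplies them for `p
≥ 16`. Removing the factors `3/4` and `8/9` from `1/ζ(2) = 6/π²` gives the interval `[9/π², 1]`. The
criterion fails at `2` and `3`, so their presence or absence is a free choice that scales this
interval by `2/3`, `3/4`, `8/9` or `1`. -/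

/-! ### Four primes between `n` and `2n` -/

/-- Primes strictly between `n` and `2 * n`. -/
def primesToDouble (n : ℕ) : Finset ℕ := {p ∈ Finset.Ioo n (2 * n) | p.Prime}

/-- Erdős's factorization bound, with the primes above `n` counted instead of assumed absent. Primes
in `(2n/3, n]` do not divide the binomial coefficient, and those above `√(2n)` divide it at most
once. -/
theorem centralBinom_le_pow_card_primesToDouble {n : ℕ} (hn : 2 < n) :
    n.centralBinom ≤
      (2 * n) ^ (Nat.sqrt (2 * n)) * 4 ^ (2 * n / 3) * (2 * n) ^ (primesToDouble n).card := by
  set f : ℕ → ℕ := fun p => p ^ n.centralBinom.factorization p with hf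
  set S := {p ∈ Finset.range (2 * n + 1) | p.Prime} with hS
  have h1 : n.centralBinom = ∏ p ∈ S, f p := by
    rw [← n.prod_pow_factorization_centralBinom]
    refine (Finset.prod_filter_of_ne fun p _ h => ?_).symm
    contrapose h
    rw [Nat.factorization_eq_zero_of_not_prime _ h, pow_zero]
  have hb : ∀ p ∈ S, f p ≤ (if p ≤ Nat.sqrt (2 * n) then 2 * n else 1) *
      (if p ≤ 2 * n / 3 then p else 1) * (if n < p then 2 * n else 1) := by
    intro p hp
    simp only [hS, Finset.mem_filter, Finset.mem_range] at hp
    have hp0 := hp.2.pos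
    have hle : f p ≤ 2 * n := Nat.pow_factorization_choose_le (by omega)
    have hpos1 : 1 ≤ (if p ≤ Nat.sqrt (2 * n) then 2 * n else 1) := by split_ifs <;> omega
    have hpos2 : 1 ≤ (if p ≤ 2 * n / 3 then p else 1) := by split_ifs <;> omega
    have hpos3 : 1 ≤ (if n < p then 2 * n else 1) := by split_ifs <;> omega
    by_cases c3 : n < p
    · rw [if_pos c3]
      exact hle.trans (Nat.le_mul_of_pos_left _ (Nat.mul_pos hpos1 hpos2))
    rw [if_neg c3, mul_one]
    by_cases c1 : p ≤ Nat.sqrt (2 * n)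
    · rw [if_pos c1]
      exact hle.trans (Nat.le_mul_of_pos_right _ hpos2)
    rw [if_neg c1, one_mul]
    by_cases c2 : p ≤ 2 * n / 3
    · rw [if_pos c2]
      refine (pow_right_mono₀ hp.2.one_lt.le ?_).trans (pow_one p).le
      exact Nat.factorization_choose_le_one (Nat.sqrt_lt'.mp <| not_le.1 c1)
    · rw [if_neg c2]
      simp only [hf]
      rw [Nat.factorization_centralBinom_of_two_mul_self_lt_three_mul hn (by omega) (by omega),
        pow_zero]
  conv_lhs => rw [h1]
  refine (Finset.prod_le_prod' hb).trans ?_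
  rw [Finset.prod_mul_distrib, Finset.prod_mul_distrib]
  have e1 : ∏ p ∈ S, (if p ≤ Nat.sqrt (2 * n) then 2 * n else 1) ≤
      (2 * n) ^ (Nat.sqrt (2 * n)) := by
    rw [← Finset.prod_filter, Finset.prod_const]
    refine pow_right_mono₀ (by omega) ?_
    have : (Finset.Icc 1 (Nat.sqrt (2 * n))).card = Nat.sqrt (2 * n) := by simp
    refine (Finset.card_le_card fun x hx => ?_).trans this.le
    simp only [hS, Finset.mem_filter] at hx
    exact Finset.mem_Icc.mpr ⟨hx.1.2.pos, hx.2⟩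
  have e2 : ∏ p ∈ S, (if p ≤ 2 * n / 3 then p else 1) ≤ 4 ^ (2 * n / 3) := by
    refine le_trans ?_ (primorial_le_four_pow (2 * n / 3))
    rw [← Finset.prod_filter]
    refine Finset.prod_le_prod_of_subset_of_one_le' (fun x hx => ?_)
      fun p hp _ => (Finset.mem_filter.1 hp).2.one_lt.le
    simp only [hS, Finset.mem_filter, Finset.mem_range] at hx ⊢
    exact ⟨by omega, hx.1.2⟩
  have e3 : ∏ p ∈ S, (if n < p then 2 * n else 1) ≤ (2 * n) ^ (primesToDouble n).card := by
    rw [← Finset.prod_filter, Finset.prod_const]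
    refine pow_right_mono₀ (by omega) (Finset.card_le_card fun x hx => ?_)
    simp only [hS, primesToDouble, Finset.mem_filter, Finset.mem_range, Finset.mem_Ioo] at hx ⊢
    refine ⟨⟨hx.2, lt_of_le_of_ne (by omega) ?_⟩, hx.1.2⟩
    rintro rfl
    exact Nat.not_prime_mul (by norm_num) (by omega) hx.1.2
  exact Nat.mul_le_mul (Nat.mul_le_mul e1 e2) e3

theorem two_mul_pow_sqrt_add_four_mul_le {n : ℕ} (hn : 1024 ≤ n) :
    (2 * n) ^ (Nat.sqrt (2 * n) + 4) * 4 ^ (2 * n / 3) ≤ 4 ^ n := by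
  have hnR : (1024 : ℝ) ≤ n := by exact_mod_cast hn
  have hn0 : (0 : ℝ) < n := by linarith
  rw [← Nat.cast_le (α := ℝ)]
  push_cast
  rw [← Real.log_le_log_iff (by positivity) (by positivity), Real.log_mul (by positivity)
    (by positivity), Real.log_pow, Real.log_pow, Real.log_pow]
  push_cast
  set y := √(2 * (n : ℝ)) with hy
  have hyy : y ^ 2 = 2 * n := Real.sq_sqrt (by positivity)
  have hy45 : 45 ≤ y := Real.le_sqrt_of_sq_le (by linarith)
  have hs : (Nat.sqrt (2 * n) : ℝ) ≤ y := by
    have := @Real.nat_sqrt_le_real_sqrt (2 * n)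
    push_cast at this
    exact this
  have hd : ((2 * n / 3 : ℕ) : ℝ) ≤ 2 * n / 3 := by
    have := @Nat.cast_div_le ℝ _ _ _ (2 * n) 3
    push_cast at this
    exact this
  have h4 : Real.log 4 = 2 * Real.log 2 := by
    rw [show (4 : ℝ) = 2 ^ 2 by norm_num, Real.log_pow]; norm_num
  have h64 : Real.log 64 = 6 * Real.log 2 := by
    rw [show (64 : ℝ) = 2 ^ 6 by norm_num, Real.log_pow]; norm_num
  have hlogn : Real.log (2 * n) = 2 * Real.log y := by
    rw [← hyy, Real.log_pow]; norm_num
  -- Tangent line of `log` at `64`; below, `3.16` bounds `6 log 2 - 1`.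
  have hlogy : Real.log y ≤ 6 * Real.log 2 + y / 64 - 1 := by
    have := Real.log_le_sub_one_of_pos (show 0 < y / 64 by positivity)
    rw [Real.log_div (by positivity) (by norm_num), h64] at this
    linarith
  have hl1 := Real.log_two_gt_d9
  have hl2 := Real.log_two_lt_d9
  have hlogy0 : 0 ≤ Real.log y := Real.log_nonneg (by linarith)
  rw [hlogn, h4]
  have k1 : ((Nat.sqrt (2 * n) : ℝ) + 4) * (2 * Real.log y) ≤
      (y + 4) * (2 * (3.16 + y / 64)) := by
    gcongr
    linarith
  have k2 : ((2 * n / 3 : ℕ) : ℝ) * (2 * Real.log 2) ≤ 2 * n / 3 * (2 * Real.log 2) := by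
    gcongr
  have k3 : (0.69 : ℝ) * y ^ 2 ≤ Real.log 2 * y ^ 2 := by
    gcongr
    linarith
  nlinarith

theorem four_le_card_primesToDouble_of_primes {n a b c d : ℕ} (ha : a.Prime) (hb : b.Prime)
    (hc : c.Prime) (hd : d.Prime) (hab : a < b) (hbc : b < c) (hcd : c < d) (hn : n < a)
    (hdn : d < 2 * n) : 4 ≤ (primesToDouble n).card := by
  have h : ({a, b, c, d} : Finset ℕ) ⊆ primesToDouble n := by
    intro x hx
    simp only [Finset.mem_insert, Finset.mem_singleton] at hx
    simp only [primesToDouble, Finset.mem_filter, Finset.mem_Ioo]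
    rcases hx with rfl | rfl | rfl | rfl
    · exact ⟨by omega, ha⟩
    · exact ⟨by omega, hb⟩
    · exact ⟨by omega, hc⟩
    · exact ⟨by omega, hd⟩
  refine le_trans (le_of_eq ?_) (Finset.card_le_card h)
  rw [Finset.card_insert_of_notMem, Finset.card_insert_of_notMem, Finset.card_insert_of_notMem,
    Finset.card_singleton] <;> simp <;> omega

/-- There are at least four primes strictly between `n` and `2 * n` for `n ≥ 16`. -/
theorem four_le_card_primesToDouble {n : ℕ} (hn : 16 ≤ n) : 4 ≤ (primesToDouble n).card := by
  rcases le_or_gt 1024 n with h | h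
  · by_contra! hlt
    have h1 := Nat.four_pow_lt_mul_centralBinom n (by omega)
    have h2 := centralBinom_le_pow_card_primesToDouble (n := n) (by omega)
    have h3 : (2 * n) ^ (primesToDouble n).card ≤ (2 * n) ^ 3 :=
      pow_right_mono₀ (by omega) (by omega)
    have h4 := two_mul_pow_sqrt_add_four_mul_le h
    have h5 : n * n.centralBinom ≤ (2 * n) * ((2 * n) ^ (Nat.sqrt (2 * n)) * 4 ^ (2 * n / 3) *
        (2 * n) ^ 3) :=
      Nat.mul_le_mul (by omega) (h2.trans (Nat.mul_le_mul_left _ h3))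
    -- The exponent `+ 4` is three primes plus the factor `2 * n` that absorbs `n`.
    have h6 : (2 * n) * ((2 * n) ^ (Nat.sqrt (2 * n)) * 4 ^ (2 * n / 3) * (2 * n) ^ 3) =
        (2 * n) ^ (Nat.sqrt (2 * n) + 4) * 4 ^ (2 * n / 3) := by ring
    omega
  have key (a b c d : ℕ) (h : a.Prime ∧ b.Prime ∧ c.Prime ∧ d.Prime ∧ a < b ∧ b < c ∧ c < d)
      (hn : n < a) (hdn : d < 2 * n) : 4 ≤ (primesToDouble n).card :=
    four_le_card_primesToDouble_of_primes h.1 h.2.1 h.2.2.1 h.2.2.2.1 h.2.2.2.2.1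
      h.2.2.2.2.2.1 h.2.2.2.2.2.2 hn hdn
  -- Each quadruple starts at the current upper bound for `n` and ends below twice the previous one.
  rcases lt_or_ge n 19 with h1 | h1
  · exact key 19 23 29 31 (by norm_num) h1 (by omega)
  rcases lt_or_ge n 23 with h2 | h2
  · exact key 23 29 31 37 (by norm_num) h2 (by omega)
  rcases lt_or_ge n 29 with h3 | h3
  · exact key 29 31 37 41 (by norm_num) h3 (by omega)
  rcases lt_or_ge n 41 with h4 | h4
  · exact key 41 43 47 53 (by norm_num) h4 (by omega)
  rcases lt_or_ge n 67 with h5 | h5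
  · exact key 67 71 73 79 (by norm_num) h5 (by omega)
  rcases lt_or_ge n 109 with h6 | h6
  · exact key 109 113 127 131 (by norm_num) h6 (by omega)
  rcases lt_or_ge n 193 with h7 | h7
  · exact key 193 197 199 211 (by norm_num) h7 (by omega)
  rcases lt_or_ge n 367 with h8 | h8
  · exact key 367 373 379 383 (by norm_num) h8 (by omega)
  rcases lt_or_ge n 709 with h9 | h9
  · exact key 709 719 727 733 (by norm_num) h9 (by omega)
  · exact key 1373 1381 1399 1409 (by norm_num) (by omega) (by omega)

/-- For a prime `n ≥ 5`, finitely many larger primes `q` satisfy `∑ 1 / q ^ 2 ≥ 1 / (n ^ 2 - 1)`. -/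
theorem exists_primes_sum_inv_sq_ge {n : ℕ} (hp : n.Prime) (h5 : 5 ≤ n) :
    ∃ T : Finset ℕ, (∀ q ∈ T, q.Prime ∧ n < q) ∧
      1 / ((n : ℝ) ^ 2 - 1) ≤ ∑ q ∈ T, 1 / (q : ℝ) ^ 2 := by
  rcases le_or_gt 16 n with h | h
  · refine ⟨primesToDouble n, fun q hq => ?_, ?_⟩
    · simp only [primesToDouble, Finset.mem_filter, Finset.mem_Ioo] at hq
      exact ⟨hq.2, hq.1.1⟩
    have hn : (16 : ℝ) ≤ n := by exact_mod_cast h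
    have h1 : ∀ q ∈ primesToDouble n, 1 / (2 * (n : ℝ) - 1) ^ 2 ≤ 1 / (q : ℝ) ^ 2 := by
      intro q hq
      simp only [primesToDouble, Finset.mem_filter, Finset.mem_Ioo] at hq
      have hq0 : (0 : ℝ) < q := by exact_mod_cast hq.2.pos
      have hq1 : (q : ℝ) + 1 ≤ 2 * n := by exact_mod_cast hq.1.2
      gcongr
      linarith
    refine le_trans ?_ (Finset.card_nsmul_le_sum _ _ _ h1)
    rw [nsmul_eq_mul]
    have h4 : (4 : ℝ) ≤ (primesToDouble n).card := by
      exact_mod_cast four_le_card_primesToDouble h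
    have hpos : (0 : ℝ) < (2 * (n : ℝ) - 1) ^ 2 := by
      have : (0 : ℝ) < 2 * (n : ℝ) - 1 := by linarith
      positivity
    calc 1 / ((n : ℝ) ^ 2 - 1) ≤ 4 * (1 / (2 * (n : ℝ) - 1) ^ 2) := by
          rw [mul_one_div, div_le_div_iff₀ (by nlinarith) hpos]
          nlinarith
      _ ≤ _ := by gcongr
  · have hcases : n = 5 ∨ n = 7 ∨ n = 11 ∨ n = 13 := by
      interval_cases n <;> simp_all +decide
    rcases hcases with rfl | rfl | rfl | rfl
    · exact ⟨{7, 11, 13, 17, 19, 23}, by simp; norm_num, by simp; norm_num⟩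
    · exact ⟨{11, 13, 17, 19, 23}, by simp; norm_num, by simp; norm_num⟩
    · exact ⟨{13, 17, 19}, by simp; norm_num, by simp; norm_num⟩
    · exact ⟨{17, 19, 23}, by simp; norm_num, by simp; norm_num⟩

/-! ### Kakeya's theorem on subsums -/

/-- The greedy algorithm behind Kakeya's theorem on sets of subsums: if each term of a nonnegative
summable series is at most the sum of the later terms, then every `x` in `[0, ∑ a]` is
approximated from below by a subsum of the first `n` terms, up to the `n`-th tail. -/
theorem exists_subsum_le_and_le_add_tail {a : ℕ → ℝ} (ha : Summable a)
    (hk : ∀ n, a n ≤ ∑' k, a (k + (n + 1))) {x : ℝ} (hx0 : 0 ≤ x) (hx : x ≤ ∑' k, a k) (n : ℕ) :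
    ∃ S ⊆ Finset.range n, ∑ k ∈ S, a k ≤ x ∧ x ≤ ∑ k ∈ S, a k + ∑' k, a (k + n) := by
  induction n with
  | zero => exact ⟨∅, by simp, by simpa using hx0, by simpa using hx⟩
  | succ n ih =>
    obtain ⟨S, hS, h1, h2⟩ := ih
    have htail : ∑' k, a (k + n) = a n + ∑' k, a (k + (n + 1)) := by
      rw [((summable_nat_add_iff n).2 ha).tsum_eq_zero_add, zero_add]
      congr 1
      exact tsum_congr fun k => by congr 1; ring
    have hnS : n ∉ S := fun h => by simpa using hS h
    have hsub : Finset.range n ⊆ Finset.range (n + 1) := Finset.range_mono (Nat.le_succ n)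
    by_cases hc : ∑ k ∈ S, a k + a n ≤ x
    · refine ⟨insert n S, ?_, ?_, ?_⟩
      · exact Finset.insert_subset (by simp) (hS.trans hsub)
      · rw [Finset.sum_insert hnS]; linarith
      · rw [Finset.sum_insert hnS]; linarith
    -- A rejected term overshoots `x`, and the later tail is at least that term.
    · exact ⟨S, hS.trans hsub, h1, by linarith [hk n]⟩

theorem Icc_subset_closure_subsums {a : ℕ → ℝ} (ha : Summable a)
    (hk : ∀ n, a n ≤ ∑' k, a (k + (n + 1))) :
    Set.Icc 0 (∑' k, a k) ⊆ closure (Set.range fun S : Finset ℕ => ∑ k ∈ S, a k) := by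
  rintro x ⟨hx0, hx⟩
  choose S _ h1 h2 using exists_subsum_le_and_le_add_tail ha hk hx0 hx
  have ht : Filter.Tendsto (fun n => x - ∑' k, a (k + n)) Filter.atTop (nhds x) := by
    simpa using tendsto_const_nhds.sub (tendsto_sum_nat_add a)
  refine mem_closure_of_tendsto (tendsto_of_tendsto_of_tendsto_of_le_of_le ht tendsto_const_nhds
    (fun n => ?_) h1) (Filter.Eventually.of_forall fun n => ⟨S n, rfl⟩)
  simpa [sub_le_iff_le_add] using h2 n

/-! ### Logarithmic weights of the primes `p ≥ 5` -/

theorem one_sub_one_div_sq_pos {n : ℕ} (hn : 2 ≤ n) : (0 : ℝ) < 1 - 1 / (n : ℝ) ^ 2 := by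
  have h : (2 : ℝ) ≤ n := by exact_mod_cast hn
  rw [sub_pos, div_lt_one (by positivity)]
  nlinarith

theorem one_div_sq_le_neg_log {n : ℕ} (hn : 2 ≤ n) :
    1 / (n : ℝ) ^ 2 ≤ -Real.log (1 - 1 / (n : ℝ) ^ 2) := by
  linarith [Real.log_le_sub_one_of_pos (one_sub_one_div_sq_pos hn)]

theorem neg_log_le_one_div_sq_sub_one {n : ℕ} (hn : 2 ≤ n) :
    -Real.log (1 - 1 / (n : ℝ) ^ 2) ≤ 1 / ((n : ℝ) ^ 2 - 1) := by
  have h : (2 : ℝ) ≤ n := by exact_mod_cast hn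
  have h1 : (n : ℝ) ^ 2 - 1 ≠ 0 := by nlinarith
  have h2 := Real.one_sub_inv_le_log_of_pos (one_sub_one_div_sq_pos hn)
  have h3 : (1 - 1 / (n : ℝ) ^ 2)⁻¹ = 1 + 1 / ((n : ℝ) ^ 2 - 1) := by
    rw [inv_eq_one_div]
    field_simp
    ring
  linarith

/-- `-log (1 - 1 / n ^ 2)` for primes `n ≥ 5`, and `0` otherwise. -/
noncomputable def logWeight (n : ℕ) : ℝ :=
  if n.Prime ∧ 5 ≤ n then -Real.log (1 - 1 / (n : ℝ) ^ 2) else 0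

theorem logWeight_nonneg (n : ℕ) : 0 ≤ logWeight n := by
  unfold logWeight
  split_ifs with h
  · exact le_trans (by positivity) (one_div_sq_le_neg_log (by omega))
  · exact le_rfl

theorem summable_logWeight : Summable logWeight := by
  refine Summable.of_nonneg_of_le logWeight_nonneg (fun n => ?_)
    (hasSum_zeta_two.summable.mul_left 2)
  unfold logWeight
  split_ifs with h
  · refine (neg_log_le_one_div_sq_sub_one (by omega)).trans ?_
    have hn : (5 : ℝ) ≤ n := by exact_mod_cast h.2
    rw [mul_one_div, div_le_div_iff₀ (by nlinarith) (by positivity)]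
    nlinarith
  · positivity

theorem logWeight_le_tail (n : ℕ) : logWeight n ≤ ∑' k, logWeight (k + (n + 1)) := by
  by_cases h : n.Prime ∧ 5 ≤ n
  · obtain ⟨T, hT, hle⟩ := exists_primes_sum_inv_sq_ge h.1 h.2
    have h1 : logWeight n ≤ ∑ q ∈ T, logWeight q := by
      rw [logWeight, if_pos h]
      refine (neg_log_le_one_div_sq_sub_one (by omega)).trans (hle.trans ?_)
      refine Finset.sum_le_sum fun q hq => ?_
      have := hT q hq
      rw [logWeight, if_pos ⟨this.1, by omega⟩]
      exact one_div_sq_le_neg_log (by omega)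
    have hdisj : Disjoint (Finset.range (n + 1)) T := by
      rw [Finset.disjoint_left]
      intro q hq hqT
      have := hT q hqT
      have := Finset.mem_range.1 hq
      omega
    have h2 := summable_logWeight.sum_le_tsum (Finset.range (n + 1) ∪ T)
      fun i _ => logWeight_nonneg i
    rw [Finset.sum_union hdisj] at h2
    have h3 := summable_logWeight.sum_add_tsum_nat_add (n + 1)
    linarith
  · rw [logWeight, if_neg h]
    exact tsum_nonneg fun k => logWeight_nonneg _

theorem exp_neg_sum_logWeight {S : Finset ℕ} (hS : ∀ p ∈ S, p.Prime ∧ 5 ≤ p) :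
    Real.exp (-∑ p ∈ S, logWeight p) = ∏ p ∈ S, (1 - 1 / (p : ℝ) ^ 2) := by
  rw [← Finset.sum_neg_distrib, Real.exp_sum]
  refine Finset.prod_congr rfl fun p hp => ?_
  have := hS p hp
  rw [logWeight, if_pos this, neg_neg, Real.exp_log (one_sub_one_div_sq_pos (by omega))]

/-! ### Euler product and the products over primes `p ≥ 5` -/

theorem hasProd_one_sub_one_div_prime_sq :
    HasProd (fun p : Nat.Primes => 1 - 1 / ((p : ℕ) : ℝ) ^ 2) (6 / Real.pi ^ 2) := by
  let f : ℕ →*₀ ℝ :=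
    { toFun := fun n => 1 / (n : ℝ) ^ 2
      map_zero' := by simp
      map_one' := by simp
      map_mul' := fun m n => by push_cast; rw [mul_pow, one_div_mul_one_div] }
  have hf : ∀ n, f n = 1 / (n : ℝ) ^ 2 := fun n => rfl
  have hs : Summable (fun n => ‖f n‖) := by
    simp_rw [hf]
    exact hasSum_zeta_two.summable.norm
  have h := EulerProduct.eulerProduct_completely_multiplicative_hasProd hs
  rw [show ∑' n, f n = Real.pi ^ 2 / 6 from hasSum_zeta_two.tsum_eq] at h
  have h' := h.inv₀ (by positivity)
  simpa [hf, inv_div] using h'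

theorem exp_neg_tsum_logWeight : Real.exp (-∑' k, logWeight k) = 9 / Real.pi ^ 2 := by
  have h1 : HasProd (fun n : ℕ => Real.exp (-logWeight n)) (Real.exp (-∑' k, logWeight k)) :=
    summable_logWeight.hasSum.neg.rexp
  -- The factors at `2` and `3`, spread over `ℕ` so that they multiply termwise with `h1`.
  have h2 : HasProd (fun n : ℕ => ∏ p ∈ ({2, 3} : Finset ℕ),
      if n = p then 1 - 1 / (p : ℝ) ^ 2 else 1)
      (∏ p ∈ ({2, 3} : Finset ℕ), (1 - 1 / (p : ℝ) ^ 2)) :=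
    hasProd_prod fun p _ => hasProd_ite_eq p _
  have h3 := h1.mul h2
  have h4 : HasProd (Set.mulIndicator {p : ℕ | p.Prime} fun n : ℕ => 1 - 1 / (n : ℝ) ^ 2)
      (6 / Real.pi ^ 2) :=
    hasProd_subtype_iff_mulIndicator.1 hasProd_one_sub_one_div_prime_sq
  have h5 : (Set.mulIndicator {p : ℕ | p.Prime} fun n : ℕ => 1 - 1 / (n : ℝ) ^ 2) =
      fun n : ℕ => Real.exp (-logWeight n) * ∏ p ∈ ({2, 3} : Finset ℕ),
        if n = p then 1 - 1 / (p : ℝ) ^ 2 else 1 := by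
    funext n
    rw [Finset.prod_pair (by norm_num)]
    by_cases hn : n.Prime
    · rw [Set.mulIndicator_of_mem (by exact hn)]
      by_cases h5 : 5 ≤ n
      · rw [logWeight, if_pos ⟨hn, h5⟩, neg_neg, Real.exp_log (one_sub_one_div_sq_pos (by omega)),
          if_neg (by omega), if_neg (by omega), mul_one, mul_one]
      · have : n = 2 ∨ n = 3 := by
          interval_cases n <;> simp_all +decide
        rcases this with rfl | rfl <;> simp [logWeight]
    · rw [Set.mulIndicator_of_notMem (by exact hn), logWeight, if_neg (by tauto), if_neg, if_neg]
      · simp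
      · rintro rfl; exact hn (by norm_num)
      · rintro rfl; exact hn (by norm_num)
  rw [h5] at h4
  have h6 := h3.unique h4
  rw [Finset.prod_pair (by norm_num)] at h6
  norm_num at h6
  have : (9 : ℝ) / Real.pi ^ 2 = 6 / Real.pi ^ 2 * (3 / 2) := by ring
  rw [this, ← h6]
  ring

/-- The finite products of `1 - 1 / p ^ 2` over primes `p ≥ 5`. -/
def coprimeSixProducts : Set ℝ :=
  {x | ∃ S : Finset ℕ, (∀ p ∈ S, p.Prime ∧ 5 ≤ p) ∧ x = ∏ p ∈ S, (1 - 1 / (p : ℝ) ^ 2)}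

theorem coprimeSixProducts_subset_Icc : coprimeSixProducts ⊆ Set.Icc (9 / Real.pi ^ 2) 1 := by
  rintro _ ⟨S, hS, rfl⟩
  rw [← exp_neg_sum_logWeight hS, ← exp_neg_tsum_logWeight]
  constructor
  · exact Real.exp_le_exp.2 (neg_le_neg
      (summable_logWeight.sum_le_tsum S fun i _ => logWeight_nonneg i))
  · rw [Real.exp_le_one_iff, neg_nonpos]
    exact Finset.sum_nonneg fun i _ => logWeight_nonneg i

theorem Icc_subset_closure_coprimeSixProducts :
    Set.Icc (9 / Real.pi ^ 2) 1 ⊆ closure coprimeSixProducts := by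
  rintro x ⟨hx1, hx2⟩
  have hx0 : 0 < x := lt_of_lt_of_le (by positivity) hx1
  have hmem : -Real.log x ∈ Set.Icc 0 (∑' k, logWeight k) := by
    constructor
    · linarith [Real.log_nonpos hx0.le hx2]
    · rw [← exp_neg_tsum_logWeight, ← Real.le_log_iff_exp_le hx0] at hx1
      linarith
  have h := Icc_subset_closure_subsums summable_logWeight logWeight_le_tail hmem
  have hc : Continuous fun t : ℝ => Real.exp (-t) := by fun_prop
  have h' := image_closure_subset_closure_image hc (Set.mem_image_of_mem _ h)
  simp only [neg_neg, Real.exp_log hx0] at h'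
  refine closure_mono ?_ h'
  rintro _ ⟨_, ⟨S, rfl⟩, rfl⟩
  -- Indices of weight `0` are dropped without changing the sum.
  refine ⟨{p ∈ S | p.Prime ∧ 5 ≤ p}, fun p hp => (Finset.mem_filter.1 hp).2, ?_⟩
  rw [← exp_neg_sum_logWeight fun p hp => (Finset.mem_filter.1 hp).2]
  simp only
  rw [Finset.sum_filter_of_ne fun p _ hp => ?_]
  contrapose hp
  rw [logWeight, if_neg hp]

/-! ### Densities and the four intervals -/

theorem visibleDensity_eq_prod_primeFactors (n : ℕ) {b : ℤ} (hb : b ≠ 0) :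
    visibleDensity n b = ∏ p ∈ b.natAbs.primeFactors, (1 - 1 / (p : ℝ) ^ n) := by
  rw [← Finset.tprod_subtype]
  exact (Equiv.subtypeEquivRight fun p => by
    rw [Nat.mem_primeFactors, Int.natCast_dvd]; simp [hb]).tprod_eq
    fun p : {p // p ∈ b.natAbs.primeFactors} => 1 - 1 / ((p : ℕ) : ℝ) ^ n

theorem visibleDensity_two_zero : visibleDensity 2 0 = 6 / Real.pi ^ 2 := by
  rw [← hasProd_one_sub_one_div_prime_sq.tprod_eq]
  exact (Equiv.subtypeEquivRight fun p => by simp).tprod_eq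
    fun p : Nat.Primes => 1 - 1 / ((p : ℕ) : ℝ) ^ 2

theorem visibleDensity_prod_primes (n : ℕ) {S : Finset ℕ} (hS : ∀ p ∈ S, p.Prime) :
    visibleDensity n (∏ p ∈ S, p : ℕ) = ∏ p ∈ S, (1 - 1 / (p : ℝ) ^ n) := by
  rw [visibleDensity_eq_prod_primeFactors n, Int.natAbs_natCast, Nat.primeFactors_prod hS]
  exact_mod_cast Finset.prod_ne_zero_iff.2 fun p hp => (hS p hp).ne_zero

/-- `F` is the chosen set of small primes; the integers `∏ p ∈ F ∪ S, p` realize `c` times the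
products over `S`. -/
theorem mem_closure_densitySet_two {F : Finset ℕ} (hF : F ⊆ {2, 3}) {c : ℝ}
    (hc : ∏ p ∈ F, (1 - 1 / (p : ℝ) ^ 2) = c) {x : ℝ}
    (hx : x / c ∈ Set.Icc (9 / Real.pi ^ 2) 1) : x ∈ closure (densitySet 2) := by
  have hFp : ∀ p ∈ F, p.Prime ∧ p < 5 := by
    intro p hp
    have := hF hp
    simp only [Finset.mem_insert, Finset.mem_singleton] at this
    rcases this with rfl | rfl <;> norm_num
  have hc0 : c ≠ 0 := by
    rw [← hc]
    exact Finset.prod_ne_zero_iff.2 fun p hp =>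
      (one_sub_one_div_sq_pos (hFp p hp).1.two_le).ne'
  have h := image_closure_subset_closure_image (continuous_const_mul c)
    (Set.mem_image_of_mem _ (Icc_subset_closure_coprimeSixProducts hx))
  rw [mul_div_cancel₀ _ hc0] at h
  refine closure_mono ?_ h
  rintro _ ⟨_, ⟨S, hS, rfl⟩, rfl⟩
  refine ⟨(∏ p ∈ F ∪ S, p : ℕ), ?_⟩
  rw [visibleDensity_prod_primes, Finset.prod_union, hc]
  · rw [Finset.disjoint_left]
    intro p hp hp'
    have := hFp p hp
    have := hS p hp'
    omega
  · intro p hp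
    rcases Finset.mem_union.1 hp with hp | hp
    · exact (hFp p hp).1
    · exact (hS p hp).1

/-- The value at `b ≠ 0` splits into the factors at `2` and `3` and a product over larger primes. -/
theorem visibleDensity_two_eq_mul {b : ℤ} (hb : b ≠ 0) :
    ∃ y ∈ Set.Icc (9 / Real.pi ^ 2) 1, visibleDensity 2 b =
      (if (2 : ℤ) ∣ b then 3 / 4 else 1) * (if (3 : ℤ) ∣ b then 8 / 9 else 1) * y := by
  set P := b.natAbs.primeFactors with hP
  have hmem (p : ℕ) (hp : p.Prime) : p ∈ P ↔ (p : ℤ) ∣ b := by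
    rw [hP, Nat.mem_primeFactors, Int.natCast_dvd]
    simp [hp, hb]
  refine ⟨_, coprimeSixProducts_subset_Icc ⟨{p ∈ P | 5 ≤ p}, fun p hp => ?_, rfl⟩, ?_⟩
  · obtain ⟨h1, h2⟩ := Finset.mem_filter.1 hp
    exact ⟨Nat.prime_of_mem_primeFactors h1, h2⟩
  rw [visibleDensity_eq_prod_primeFactors 2 hb, ← hP,
    ← Finset.prod_filter_mul_prod_filter_not P (5 ≤ ·), mul_comm]
  congr 1
  have h1 : {p ∈ P | ¬5 ≤ p} = {p ∈ ({2, 3} : Finset ℕ) | p ∈ P} := by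
    ext p
    simp only [Finset.mem_filter, Finset.mem_insert, Finset.mem_singleton]
    constructor
    · rintro ⟨h1, h2⟩
      refine ⟨?_, h1⟩
      have := Nat.prime_of_mem_primeFactors h1
      push Not at h2
      interval_cases p <;> simp_all +decide
    · rintro ⟨h1, h2⟩
      exact ⟨h2, by omega⟩
  rw [h1, Finset.prod_filter, Finset.prod_pair (by norm_num)]
  simp only [hmem 2 Nat.prime_two, hmem 3 Nat.prime_three]
  norm_num

theorem theorem5p5 :
    closure (densitySet 2) =
      Set.Icc (6 / Real.pi ^ 2) (2 / 3) ∪ Set.Icc (27 / (4 * Real.pi ^ 2)) (3 / 4) ∪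
        Set.Icc (8 / Real.pi ^ 2) (8 / 9) ∪ Set.Icc (9 / Real.pi ^ 2) 1 := by
  have e6 : 6 / Real.pi ^ 2 = 2 / 3 * (9 / Real.pi ^ 2) := by ring
  have e27 : 27 / (4 * Real.pi ^ 2) = 3 / 4 * (9 / Real.pi ^ 2) := by
    rw [div_mul_div_comm]; norm_num
  have e8 : 8 / Real.pi ^ 2 = 8 / 9 * (9 / Real.pi ^ 2) := by ring
  have h9 : 9 / Real.pi ^ 2 ≤ 1 := by
    rw [div_le_one (by positivity)]
    nlinarith [Real.pi_gt_three]
  apply Set.Subset.antisymm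
  · refine closure_minimal ?_ (((isClosed_Icc.union isClosed_Icc).union isClosed_Icc).union
      isClosed_Icc)
    rintro _ ⟨b, rfl⟩
    rw [e27, e8]
    by_cases hb : b = 0
    · rw [hb, visibleDensity_two_zero]
      -- `b = 0` gives exactly the left endpoint of the first interval.
      exact Or.inl (Or.inl (Or.inl ⟨le_rfl, by rw [e6]; linarith⟩))
    rw [e6]
    obtain ⟨y, ⟨hy1, hy2⟩, hy⟩ := visibleDensity_two_eq_mul hb
    rw [hy]
    by_cases h2 : (2 : ℤ) ∣ b <;> by_cases h3 : (3 : ℤ) ∣ b <;>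
      simp only [h2, h3, if_true, if_false]
    · exact Or.inl (Or.inl (Or.inl ⟨by linarith, by linarith⟩))
    · exact Or.inl (Or.inl (Or.inr ⟨by linarith, by linarith⟩))
    · exact Or.inl (Or.inr ⟨by linarith, by linarith⟩)
    · exact Or.inr ⟨by linarith, by linarith⟩
  · rw [e6, e27, e8]
    rintro x (((⟨h1, h2⟩ | ⟨h1, h2⟩) | ⟨h1, h2⟩) | ⟨h1, h2⟩)
    · refine mem_closure_densitySet_two (F := {2, 3}) (c := 2 / 3) subset_rfl ?_ ?_
      · rw [Finset.prod_pair (by norm_num)]; norm_num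
      · constructor <;> linarith
    · refine mem_closure_densitySet_two (F := {2}) (c := 3 / 4) (by simp) ?_ ?_
      · rw [Finset.prod_singleton]; norm_num
      · constructor <;> linarith
    · refine mem_closure_densitySet_two (F := {3}) (c := 8 / 9) (by simp) ?_ ?_
      · rw [Finset.prod_singleton]; norm_num
      · constructor <;> linarith
    · refine mem_closure_densitySet_two (F := ∅) (c := 1) (by simp) (by simp) ?_
      · constructor <;> linarith
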